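/- Let $K$ be a field. A rooted tree quiver is a finite directed graph whose underlying graph is a tree and which has a unique sink, called its root. A quiver over $Q$ is a quiver $Q'$ together with a map of directed graphs $c\colon Q'\to Q$; isomorphisms of quivers over $Q$ commute with the structure maps. Representations are finite dimensional over $K$; $\mathbb{1}_{Q'}$ denotes the representation of $Q'$ with $K$ at every vertex and the identity map at every arrow; and for a representation $V$ of $Q'$ (with $Q'$ finite) the pushforward $c_*V$ is the representation of $Q$ with $(c_*V)_x=\bigoplus_{y\in c^{-1}(x)}V_y$ for each vertex $x$ and $(c_*V)_a=\sum_{b\in c^{-1}(a)}V_b$ for each arrow $a$. Let $Q$ be a rooted tree quiver. For each vertex $x$ of $Q$ define recursively a finite distributive lattice $$L_{Q,x}=\prod_{a\colon y\to x}J(L_{Q,y}),$$ the product over all arrows $a$ of $Q$ with head $x$, where $J(A)$ is the lattice of order ideals (down-sets, including $\emptyset$) of a poset $A$, ordered by inclusion (so $L_{Q,x}$ has one element if $x$ is not the head of any arrow). For $M=(M_a)_a\in L_{Q,x}$ define recursively a quiver $Q_M$ with a distinguished vertex $\sigma_M$ and a map $c_M\colon Q_M\to Q$ with $c_M(\sigma_M)=x$: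 for each arrow $a\colon y\to x$ and each maximal element $S$ of the ideal $M_a\subseteq L_{Q,y}$, take the one-point extension of $Q_S$ by a new arrow, mapped to $a$, from $\sigma_S$ to a new vertex, mapped to $x$; then $Q_M$ is obtained by gluing all these extensions at their new vertices, the common vertex being $\sigma_M$ (if all $M_a$ are empty, $Q_M$ is the single vertex $\sigma_M$). Put $L_Q=\coprod_x L_{Q,x}$. A quiver over $Q$ is called reduced if it is isomorphic over $Q$ to $(Q_M,c_M)$ for some $M\in L_Q$, and $\mathbb{1}_M:=(c_M)_*\mathbb{1}_{Q_M}$ is the reduced representation of $Q$ attached to $M$. Then for every rooted tree quiver $Q'$ over $Q$ with structure map $c\colon Q'\to Q$, the representation $c_*\mathbb{1}_{Q'}$ of $Q$ is indecomposable if and only if $Q'$ is a reduced quiver over $Q$. Moreover, the reduced representations $\mathbb{1}_M$, $M\in L_Q$, are indecomposable, and $\mathbb{1}_M\not\cong\mathbb{1}_N$ whenever $M\neq N$ in $L_Q$. -/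

import Mathlib

open scoped DirectSum

universe u v u' v' k w w'

set_option linter.checkUnivs false

/-- A quiver (directed graph): vertices, arrows, and the tail and head of each arrow. -/
structure DirGraph where
  Vert : Type u
  Arr : Type v
  tail : Arr → Vert
  head : Arr → Vert

namespace DirGraph

/-- A map of directed graphs.  A quiver over `Q` is a quiver `Q'` with a map `Q' → Q`. -/
structure Hom (Q' : DirGraph.{u', v'}) (Q : DirGraph.{u, v}) where
  vert : Q'.Vert → Q.Vert
  arr : Q'.Arr → Q.Arr
  tail_arr : ∀ a, Q.tail (arr a) = vert (Q'.tail a)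
  head_arr : ∀ a, Q.head (arr a) = vert (Q'.head a)

/-- An isomorphism of quivers over `Q`. -/
structure IsoOver {Q : DirGraph.{u, v}} {G : DirGraph.{u', v'}} {H : DirGraph.{w, w'}}
    (c : Hom G Q) (d : Hom H Q) where
  vert : G.Vert ≃ H.Vert
  arr : G.Arr ≃ H.Arr
  tail_arr : ∀ a, H.tail (arr a) = vert (G.tail a)
  head_arr : ∀ a, H.head (arr a) = vert (G.head a)
  over_vert : ∀ x, d.vert (vert x) = c.vert x
  over_arr : ∀ a, d.arr (arr a) = c.arr a

/-- The underlying simple graph: distinct vertices joined by an arrow are adjacent. -/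
def underlying (Q : DirGraph.{u, v}) : SimpleGraph Q.Vert :=
  SimpleGraph.fromRel fun x y => ∃ a, Q.tail a = x ∧ Q.head a = y

/-- A (finite) rooted tree quiver: the underlying graph is a tree, i.e. it has no loops, no
multiple edges, and is a tree as a simple graph; and there is a unique sink, called the root. -/
class IsRootedTree (Q : DirGraph.{u, v}) : Prop where
  finite_vert : Finite Q.Vert
  no_loop : ∀ a, Q.tail a ≠ Q.head a
  no_multi : ∀ a b, s(Q.tail a, Q.head a) = s(Q.tail b, Q.head b) → a = b
  isTree : Q.underlying.IsTree
  unique_sink : ∃! x : Q.Vert, ∀ a, Q.tail a ≠ x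

instance (Q : DirGraph.{u, v}) [h : Q.IsRootedTree] : Finite Q.Vert := h.finite_vert

instance (Q : DirGraph.{u, v}) [h : Q.IsRootedTree] : Finite Q.Arr :=
  Finite.of_injective (fun a => s(Q.tail a, Q.head a)) fun a b hab => h.no_multi a b hab

/-- `Q.Pred y x`: there is an arrow from `y` to `x`. -/
def Pred (Q : DirGraph.{u, v}) (y x : Q.Vert) : Prop := ∃ a, Q.tail a = y ∧ Q.head a = x

theorem exists_walk_of_transGen (Q : DirGraph.{u, v}) [hQ : Q.IsRootedTree] {x y : Q.Vert}
    (h : Relation.TransGen Q.Pred x y) :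
    ∃ (z : Q.Vert) (hxz : Q.underlying.Adj x z) (w : Q.underlying.Walk z y),
      Q.Pred x z ∧ (SimpleGraph.Walk.cons hxz w).edges.IsChain (· ≠ ·) := by
  have adj : ∀ {a b : Q.Vert}, Q.Pred a b → Q.underlying.Adj a b := by
    rintro a b ⟨e, rfl, rfl⟩
    exact (SimpleGraph.fromRel_adj _ _ _).2 ⟨hQ.no_loop e, Or.inl ⟨e, rfl, rfl⟩⟩
  induction h using Relation.TransGen.head_induction_on with
  | single h => exact ⟨_, adj h, SimpleGraph.Walk.nil, h, by simp⟩
  | @head a c h _ ih =>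
    obtain ⟨z, hxz, w, hp, hc⟩ := ih
    refine ⟨c, adj h, SimpleGraph.Walk.cons hxz w, h, ?_⟩
    simp only [SimpleGraph.Walk.edges_cons] at hc ⊢
    refine List.IsChain.cons_cons ?_ hc
    intro he
    obtain ⟨e, rfl, rfl⟩ := h
    obtain ⟨e', h1, rfl⟩ := hp
    have hee : e = e' := hQ.no_multi e e' (by rw [he, h1])
    subst hee
    exact hQ.no_loop _ h1

/-- In a rooted tree quiver, constructions may be made by recursion along arrows. -/
theorem pred_wf (Q : DirGraph.{u, v}) [hQ : Q.IsRootedTree] : WellFounded Q.Pred := by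
  have : Std.Irrefl (Relation.TransGen Q.Pred) := ⟨fun x h => by
    obtain ⟨z, hxz, w, -, hc⟩ := Q.exists_walk_of_transGen h
    have hp := (hQ.isTree.isAcyclic.isPath_iff_isChain _).2 hc
    have := SimpleGraph.Walk.isPath_iff_nil.1 hp
    simp at this⟩
  have : WellFounded (Relation.TransGen Q.Pred) := Finite.wellFounded_of_trans_of_irrefl _
  exact Subrelation.wf (fun h => Relation.TransGen.single h) this

/-- The arrows of `Q` with head `x`. -/
abbrev In (Q : DirGraph.{u, v}) (x : Q.Vert) : Type v := {a : Q.Arr // Q.head a = x}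

/-- The poset (a finite distributive lattice) attached to a vertex `x`: the product, over the
arrows `a` with head `x`, of the lattices of order ideals of the posets attached to `tail a`.
Here `tail a`, for `a` running over the arrows with head `x`, are the roots of the trees left
after removing `x` from the largest connected subquiver with sink `x`. -/
noncomputable def latAux (Q : DirGraph.{u, v}) : ∀ x : Q.Vert, Acc Q.Pred x → PartOrd.{v} :=
  fun _ h => Acc.rec (motive := fun _ _ => PartOrd.{v})
    (fun x _ ih => PartOrd.of (∀ a : Q.In x, LowerSet (ih (Q.tail a) ⟨a.1, rfl, a.2⟩))) h

/-- The lattice `L_{Q,x}`. -/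
noncomputable abbrev Lat (Q : DirGraph.{u, v}) [Q.IsRootedTree] (x : Q.Vert) : PartOrd.{v} :=
  Q.latAux x (Q.pred_wf.apply x)

/-- The set `L_Q`, the disjoint union of the lattices `L_{Q,x}`. -/
abbrev L (Q : DirGraph.{u, v}) [Q.IsRootedTree] : Type (max u v) := Σ x : Q.Vert, Q.Lat x

/-- A quiver over `Q` with a chosen vertex `root` lying over `x`. -/
structure PointedOver (Q : DirGraph.{u, v}) (x : Q.Vert) where
  G : DirGraph.{v, v}
  root : G.Vert
  c : Hom G Q
  c_root : c.vert root = x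

/-- Given quivers `P i` over `Q` with roots over the tails of arrows `a i` with head `x`, take the
one-point extension of each `P i` by a new arrow over `a i` starting at the root of `P i`, and glue
all these extensions at their new vertices, getting one new root over `x`.
The new root is `none`, the new arrow starting at the root of `P i` is `⟨i, none⟩`. -/
def graft {Q : DirGraph.{u, v}} {x : Q.Vert} {ι : Type v} (a : ι → Q.In x)
    (P : ∀ i, PointedOver Q (Q.tail (a i))) : PointedOver Q x where
  G :=
    { Vert := Option (Σ i, (P i).G.Vert)
      Arr := Σ i, Option (P i).G.Arr
      tail := fun e => match e with
        | ⟨i, none⟩ => some ⟨i, (P i).root⟩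
        | ⟨i, some b⟩ => some ⟨i, (P i).G.tail b⟩
      head := fun e => match e with
        | ⟨_, none⟩ => none
        | ⟨i, some b⟩ => some ⟨i, (P i).G.head b⟩ }
  root := none
  c :=
    { vert := fun y => match y with
        | none => x
        | some ⟨i, y⟩ => (P i).c.vert y
      arr := fun e => match e with
        | ⟨i, none⟩ => a i
        | ⟨i, some b⟩ => (P i).c.arr b
      tail_arr := by
        rintro ⟨i, _ | b⟩
        · exact (P i).c_root.symm
        · exact (P i).c.tail_arr b
      head_arr := by
        rintro ⟨i, _ | b⟩
        · exact (a i).2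
        · exact (P i).c.head_arr b }
  c_root := rfl

/-- The quiver `Q_M` over `Q` attached to an element `M = (M_a)_a` of the lattice at `x`:
for every arrow `a` with head `x` and every maximal element `S` of the ideal `M_a`, the
one-point extension along `a` of the quiver attached to `S`, all glued at their sinks. -/
noncomputable def redAux (Q : DirGraph.{u, v}) :
    ∀ (x : Q.Vert) (h : Acc Q.Pred x), Q.latAux x h → PointedOver Q x :=
  fun _ h => Acc.rec (motive := fun x h => Q.latAux x h → PointedOver Q x)
    (fun x hx ih (M : ∀ a : Q.In x, LowerSet (Q.latAux (Q.tail a) (hx _ ⟨a.1, rfl, a.2⟩))) =>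
      graft (ι := Σ a : Q.In x, {S // Maximal (· ∈ M a) S}) (fun i => i.1)
        fun i => ih (Q.tail i.1) ⟨i.1.1, rfl, i.1.2⟩ i.2.1) h

/-- The quiver `Q_M`, for `M ∈ L_Q`. -/
noncomputable abbrev red {Q : DirGraph.{u, v}} [Q.IsRootedTree] (M : Q.L) : DirGraph.{v, v} :=
  (Q.redAux M.1 _ M.2).G

/-- The structure map `c_M : Q_M → Q`, for `M ∈ L_Q`. -/
noncomputable abbrev redMap {Q : DirGraph.{u, v}} [Q.IsRootedTree] (M : Q.L) : Hom (red M) Q :=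
  (Q.redAux M.1 _ M.2).c

/-- A quiver over `Q` is reduced if it is, up to isomorphism over `Q`, one of the `Q_M`. -/
def IsReduced {Q : DirGraph.{u, v}} [Q.IsRootedTree] {Q' : DirGraph.{u', v'}}
    (c : Hom Q' Q) : Prop :=
  ∃ M : Q.L, Nonempty (IsoOver c (redMap M))

theorem finite_latAux (Q : DirGraph.{u, v}) [Finite Q.Arr] :
    ∀ (x : Q.Vert) (h : Acc Q.Pred x), Finite (Q.latAux x h) := by
  intro x h
  induction h with
  | intro x hx ih =>
    have : ∀ a : Q.In x, Finite (LowerSet (Q.latAux (Q.tail a) (hx _ ⟨a.1, rfl, a.2⟩))) := by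
      intro a
      have := ih (Q.tail a) ⟨a.1, rfl, a.2⟩
      exact Finite.of_injective _ SetLike.coe_injective
    exact inferInstanceAs
      (Finite (∀ a : Q.In x, LowerSet (Q.latAux (Q.tail a) (hx _ ⟨a.1, rfl, a.2⟩))))

theorem finite_redAux (Q : DirGraph.{u, v}) [Finite Q.Arr] :
    ∀ (x : Q.Vert) (h : Acc Q.Pred x) (M : Q.latAux x h),
      Finite (Q.redAux x h M).G.Vert ∧ Finite (Q.redAux x h M).G.Arr := by
  intro x h
  induction h with
  | intro x hx ih =>
    intro (M : ∀ a : Q.In x, LowerSet (Q.latAux (Q.tail a) (hx _ ⟨a.1, rfl, a.2⟩)))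
    have h0 : ∀ a : Q.In x, Finite (Q.latAux (Q.tail a) (hx _ ⟨a.1, rfl, a.2⟩)) :=
      fun a => Q.finite_latAux _ _
    have h1 := fun i : (Σ a : Q.In x, {S // Maximal (· ∈ M a) S}) =>
      (ih (Q.tail i.1) ⟨i.1.1, rfl, i.1.2⟩ i.2.1).1
    have h2 := fun i : (Σ a : Q.In x, {S // Maximal (· ∈ M a) S}) =>
      (ih (Q.tail i.1) ⟨i.1.1, rfl, i.1.2⟩ i.2.1).2
    exact ⟨inferInstanceAs (Finite (Option (Σ i : (Σ a : Q.In x, {S // Maximal (· ∈ M a) S}),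
        (Q.redAux (Q.tail i.1) _ i.2.1).G.Vert))),
      inferInstanceAs (Finite (Σ i : (Σ a : Q.In x, {S // Maximal (· ∈ M a) S}),
        Option (Q.redAux (Q.tail i.1) _ i.2.1).G.Arr))⟩

instance {Q : DirGraph.{u, v}} [Q.IsRootedTree] (M : Q.L) : Finite (red M).Vert :=
  (Q.finite_redAux _ _ _).1

instance {Q : DirGraph.{u, v}} [Q.IsRootedTree] (M : Q.L) : Finite (red M).Arr :=
  (Q.finite_redAux _ _ _).2

/-- A (finite dimensional) representation of `Q` over `K`. -/
structure Rep (K : Type k) [Field K] (Q : DirGraph.{u, v}) where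
  space : Q.Vert → Type w
  [addCommGroup : ∀ x, AddCommGroup (space x)]
  [module : ∀ x, Module K (space x)]
  [finite : ∀ x, FiniteDimensional K (space x)]
  map : ∀ a : Q.Arr, space (Q.tail a) →ₗ[K] space (Q.head a)

namespace Rep

attribute [instance] addCommGroup module finite

variable {K : Type k} [Field K] {Q : DirGraph.{u, v}}

/-- An isomorphism of representations. -/
structure Iso (V : Rep.{u, v, k, w} K Q) (W : Rep.{u, v, k, w'} K Q) where
  equiv : ∀ x, V.space x ≃ₗ[K] W.space x
  comm : ∀ (a : Q.Arr) (s : V.space (Q.tail a)),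
    equiv (Q.head a) (V.map a s) = W.map a (equiv (Q.tail a) s)

/-- The direct sum of two representations. -/
def sum (V : Rep.{u, v, k, w} K Q) (W : Rep.{u, v, k, w'} K Q) :
    Rep.{u, v, k, max w w'} K Q where
  space x := V.space x × W.space x
  map a := (V.map a).prodMap (W.map a)

/-- The zero representations. -/
def IsZero (V : Rep.{u, v, k, w} K Q) : Prop := ∀ x, Subsingleton (V.space x)

/-- A representation is indecomposable if it is nonzero, and whenever it is isomorphic to a direct
sum of two representations, one of these is zero. -/
def Indecomposable (V : Rep.{u, v, k, w} K Q) : Prop :=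
  ¬ V.IsZero ∧ ∀ U W : Rep.{u, v, k, w} K Q, Nonempty (V.Iso (U.sum W)) → U.IsZero ∨ W.IsZero

/-- The representation with the field at each vertex and the identity at each arrow. -/
def one (K : Type k) [Field K] (Q : DirGraph.{u, v}) : Rep.{u, v, k, k} K Q where
  space _ := K
  map _ := LinearMap.id

open Classical in
/-- The pushforward of a representation along a map of directed graphs. -/
noncomputable def pushforward {Q' : DirGraph.{u', v'}} [Finite Q'.Vert] [Finite Q'.Arr]
    (f : Hom Q' Q) (V : Rep.{u', v', k, w} K Q') : Rep.{u, v, k, max u' w} K Q where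
  space x := ⨁ y : {y : Q'.Vert // f.vert y = x}, V.space y
  finite x := by
    have := Fintype.ofFinite {y : Q'.Vert // f.vert y = x}
    infer_instance
  map a :=
    letI := Fintype.ofFinite {b : Q'.Arr // f.arr b = a}
    ∑ b : {b : Q'.Arr // f.arr b = a},
      DirectSum.lof K {y : Q'.Vert // f.vert y = Q.head a} (fun y => V.space y)
          ⟨Q'.head b, by rw [← f.head_arr, b.2]⟩ ∘ₗ
        V.map b ∘ₗ
          DirectSum.component K {y : Q'.Vert // f.vert y = Q.tail a} (fun y => V.space y)
            ⟨Q'.tail b, by rw [← f.tail_arr, b.2]⟩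

end Rep

/-- The reduced representation of `Q` attached to `M ∈ L_Q`. -/
noncomputable def redRep (K : Type k) [Field K] {Q : DirGraph.{u, v}} [Q.IsRootedTree]
    (M : Q.L) : Rep.{u, v, k, max v k} K Q :=
  Rep.pushforward (redMap M) (Rep.one K (red M))

end DirGraph

/-! Each vertex `y` of a quiver over `Q` has a shape in `L_Q`, which records the part lying above
`y`. By `shape_le_shape_iff` the order on shapes is simulation: `shape c y ≤ shape d z` when `y` and
`z` have the same image and every arrow into `y` is matched by an arrow into `z` over the same arrow
of `Q`, with tail of at least as large a shape. Call the quiver thin if siblings (arrows with the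
same head and the same image) have tails of incomparable shapes.

Reduced means thin. The maximal elements of an ideal form an antichain that generates it, so `Q_M`
is thin with root of shape `M` (`redAux_spec`), and a thin arborescence is determined by the shape
of its root (`nonempty_isoOver`).

If siblings have comparable shapes, the smaller branch folds into the larger (`exists_retraction`).
The linearized folding is an idempotent that fixes the root but is not the identity, so the
representation decomposes.

Conversely, a morphism sends the basis vector of `y` into the span of the `z` with `shape y ≤ shape
z` (`shape_le_of_single_ne_zero`). In the thin case this triangularity makes every endomorphism with
nonzero coefficient at the root injective (`IsThin.exists_map_apply_ne_zero`). Of two endomorphisms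
with sum the identity, one has such a coefficient. Triangularity for an isomorphism and its inverse
also forces equal root shapes, hence `M = N`. -/

namespace DirGraph

/-! ### Shapes of vertices and the simulation order -/

section Order

variable {Q : DirGraph.{u, v}} {G : DirGraph.{u', v'}} {H : DirGraph.{w, w'}}

/-- The element of the lattice at `x` recording the shape of the part of `G` above a vertex over
`x`: its component at `a` is the ideal generated by the elements attached to the tails of the
incoming arrows over `a`. -/
noncomputable def shapeAux (c : Hom G Q) :
    ∀ (x : Q.Vert) (h : Acc Q.Pred x), {y : G.Vert // c.vert y = x} → Q.latAux x h :=
  fun _ h => Acc.rec (motive := fun x h => {y : G.Vert // c.vert y = x} → Q.latAux x h)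
    (fun x hx ih y =>
      (fun a => lowerClosure {S | ∃ (b : G.Arr) (hb : c.arr b = a.1), G.head b = y.1 ∧
          ih (Q.tail a) ⟨a.1, rfl, a.2⟩ ⟨G.tail b, by rw [← c.tail_arr, hb]⟩ = S} :
        ∀ a : Q.In x, LowerSet (Q.latAux (Q.tail a) (hx _ ⟨a.1, rfl, a.2⟩)))) h

/-- An inclusion of the ideals generated by two sets need only be checked on generators: each must
lie below a generator of the other ideal. -/
theorem shapeAux_le_shapeAux_iff (c : Hom G Q) (d : Hom H Q) (x : Q.Vert) (h : Acc Q.Pred x)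
    (y : {y : G.Vert // c.vert y = x}) (z : {z : H.Vert // d.vert z = x}) :
    shapeAux c x h y ≤ shapeAux d x h z ↔
      ∀ b, ∀ hb : G.head b = y, ∃ b', H.head b' = z ∧ ∃ e : d.arr b' = c.arr b,
        shapeAux c (c.vert (G.tail b))
            (h.inv ⟨c.arr b, c.tail_arr b, by rw [c.head_arr, hb, y.2]⟩) ⟨G.tail b, rfl⟩ ≤
          shapeAux d _ (h.inv ⟨c.arr b, c.tail_arr b, by rw [c.head_arr, hb, y.2]⟩)
            ⟨H.tail b', by rw [← d.tail_arr, e, c.tail_arr]⟩ := by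
  cases h with
  | intro x hx =>
    -- `Q.tail (c.arr b)` and `c.vert (G.tail b)` are only propositionally equal; this carries
    -- inequalities between the two indices.
    have key : ∀ (a : Q.Arr) (h1 : Acc Q.Pred (Q.tail a)) (t : Q.Vert) (ht : Q.tail a = t)
        (h2 : Acc Q.Pred t) (p : G.Vert) (q : H.Vert) (hp : c.vert p = Q.tail a)
        (hq : d.vert q = Q.tail a) (hp' : c.vert p = t) (hq' : d.vert q = t),
        shapeAux c _ h1 ⟨p, hp⟩ ≤ shapeAux d _ h1 ⟨q, hq⟩ ↔
          shapeAux c t h2 ⟨p, hp'⟩ ≤ shapeAux d t h2 ⟨q, hq'⟩ := by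
      intro a h1 t ht h2 p q hp hq hp' hq'
      subst ht
      rfl
    change (∀ a : Q.In x, lowerClosure {S | ∃ (b : G.Arr) (hb : c.arr b = a.1), G.head b = y.1 ∧
          shapeAux c (Q.tail a) (hx _ ⟨a.1, rfl, a.2⟩)
            ⟨G.tail b, by rw [← c.tail_arr, hb]⟩ = S} ≤
        lowerClosure {S | ∃ (b : H.Arr) (hb : d.arr b = a.1), H.head b = z.1 ∧
          shapeAux d (Q.tail a) (hx _ ⟨a.1, rfl, a.2⟩)
            ⟨H.tail b, by rw [← d.tail_arr, hb]⟩ = S}) ↔ _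
    constructor
    · intro hle b hb
      have ha : Q.head (c.arr b) = x := by rw [c.head_arr, hb, y.2]
      have := hle ⟨c.arr b, ha⟩
        (subset_lowerClosure ⟨b, rfl, hb, rfl⟩)
      obtain ⟨_, ⟨b', e, hb', rfl⟩, hS⟩ := this
      exact ⟨b', hb', e, (key _ _ _ (c.tail_arr b) _ _ _ _ _ _ _).1 hS⟩
    · intro H1 a
      rw [lowerClosure_le]
      rintro _ ⟨b, hba, hb, rfl⟩
      obtain ⟨b', hb', e, hle⟩ := H1 b hb
      refine ⟨_, ⟨b', e.trans hba, hb', rfl⟩, ?_⟩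
      refine (key a.1 _ _ (by rw [← c.tail_arr, hba]) _ _ _ _ _ _ _).2 hle

variable [Q.IsRootedTree]

/-- The element of `L_Q` recording the shape of the part of `G` above a vertex. -/
noncomputable def shape (c : Hom G Q) (y : G.Vert) : Q.L :=
  ⟨c.vert y, shapeAux c _ _ ⟨y, rfl⟩⟩

theorem shape_eq (c : Hom G Q) {y : G.Vert} {x : Q.Vert} (h : c.vert y = x) :
    shape c y = ⟨x, shapeAux c x (Q.pred_wf.apply x) ⟨y, h⟩⟩ := by
  subst h; rfl

theorem shape_le_shape_iff_shapeAux {c : Hom G Q} {d : Hom H Q} {y : G.Vert} {z : H.Vert}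
    {x : Q.Vert} (h : Acc Q.Pred x) (hy : c.vert y = x) (hz : d.vert z = x) :
    shape c y ≤ shape d z ↔ shapeAux c x h ⟨y, hy⟩ ≤ shapeAux d x h ⟨z, hz⟩ := by
  obtain rfl : h = Q.pred_wf.apply x := rfl
  rw [shape_eq c hy, shape_eq d hz, Sigma.mk_le_mk_iff]

theorem shape_le_shape_iff {c : Hom G Q} {d : Hom H Q} {y : G.Vert} {z : H.Vert} :
    shape c y ≤ shape d z ↔ c.vert y = d.vert z ∧ ∀ b, G.head b = y →
      ∃ b', H.head b' = z ∧ d.arr b' = c.arr b ∧ shape c (G.tail b) ≤ shape d (H.tail b') := by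
  constructor
  · intro hle
    have hyz : c.vert y = d.vert z := (Sigma.le_def.1 hle).1
    refine ⟨hyz, ?_⟩
    rw [shape_eq d hyz.symm, shape, Sigma.mk_le_mk_iff, shapeAux_le_shapeAux_iff] at hle
    intro b hb
    obtain ⟨b', hb', e, h⟩ := hle b hb
    refine ⟨b', hb', e, ?_⟩
    rw [shape_eq d (show d.vert (H.tail b') = c.vert (G.tail b) by
      rw [← d.tail_arr, e, c.tail_arr]), shape, Sigma.mk_le_mk_iff]
    exact h
  · rintro ⟨hyz, hle⟩
    rw [shape_eq d hyz.symm, shape, Sigma.mk_le_mk_iff, shapeAux_le_shapeAux_iff]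
    intro b hb
    obtain ⟨b', hb', e, h⟩ := hle b hb
    refine ⟨b', hb', e, ?_⟩
    rw [shape_eq d (show d.vert (H.tail b') = c.vert (G.tail b) by
      rw [← d.tail_arr, e, c.tail_arr]), shape, Sigma.mk_le_mk_iff] at h
    exact h

theorem vert_eq_of_shape_le {c : Hom G Q} {d : Hom H Q} {y : G.Vert} {z : H.Vert}
    (h : shape c y ≤ shape d z) : c.vert y = d.vert z :=
  (shape_le_shape_iff.1 h).1

theorem pred_wf_of_hom (c : Hom G Q) : WellFounded G.Pred := by
  refine Subrelation.wf ?_ (InvImage.wf c.vert Q.pred_wf)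
  rintro _ _ ⟨a, rfl, rfl⟩
  exact ⟨c.arr a, c.tail_arr a, c.head_arr a⟩

/-- A map over `Q` which is bijective on the arrows into each vertex preserves shapes. -/
theorem shape_eq_of_hom {c : Hom G Q} {d : Hom H Q} (f : G.Vert → H.Vert) (g : G.Arr → H.Arr)
    (hf : ∀ y, d.vert (f y) = c.vert y) (hg : ∀ b, d.arr (g b) = c.arr b)
    (ht : ∀ b, H.tail (g b) = f (G.tail b)) (hh : ∀ b, H.head (g b) = f (G.head b))
    (hs : ∀ y b', H.head b' = f y → ∃ b, G.head b = y ∧ g b = b') (y : G.Vert) :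
    shape d (f y) = shape c y := by
  induction y using (pred_wf_of_hom c).induction with
  | h y ih =>
    apply le_antisymm
    · refine shape_le_shape_iff.2 ⟨hf y, fun b' hb' => ?_⟩
      obtain ⟨b, hb, rfl⟩ := hs y b' hb'
      exact ⟨b, hb, (hg b).symm, by rw [ht]; exact (ih _ ⟨b, rfl, hb⟩).le⟩
    · refine shape_le_shape_iff.2 ⟨(hf y).symm, fun b hb => ?_⟩
      exact ⟨g b, by rw [hh, hb], hg b, by rw [ht]; exact (ih _ ⟨b, rfl, hb⟩).ge⟩

end Order

end DirGraph

namespace DirGraph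

/-! ### Arborescences over `Q` and the rigidity of thin ones -/

section Arborescence

variable {Q : DirGraph.{u, v}} {G : DirGraph.{u', v'}} {H : DirGraph.{w, w'}}

/-- Every vertex except `r` is the tail of exactly one arrow, and `r` is the tail of none. -/
structure IsArborescence (G : DirGraph.{u', v'}) (r : G.Vert) : Prop where
  tail_injective : Function.Injective G.tail
  tail_ne : ∀ b, G.tail b ≠ r
  exists_tail : ∀ y, y ≠ r → ∃ b, G.tail b = y

/-- Uniqueness of the sink makes `tail` surjective onto the other vertices. Arrows embed into the
edges of the tree, one fewer than the vertices, so counting makes it bijective. -/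
theorem IsRootedTree.exists_isArborescence (G : DirGraph.{u', v'}) [hG : G.IsRootedTree] :
    ∃ r, G.IsArborescence r := by
  classical
  obtain ⟨r, hr, huniq⟩ := hG.unique_sink
  have hex : ∀ y, y ≠ r → ∃ b, G.tail b = y := by
    intro y hy
    by_contra hno
    push Not at hno
    exact hy (huniq y hno)
  refine ⟨r, ?_, hr, hex⟩
  have := Fintype.ofFinite G.Vert
  have := Fintype.ofFinite G.Arr
  have hcard := hG.isTree.card_edgeFinset
  let f : G.Arr → {y // y ≠ r} := fun b => ⟨G.tail b, hr b⟩
  have hf : Function.Surjective f := by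
    rintro ⟨y, hy⟩
    obtain ⟨b, rfl⟩ := hex y hy
    exact ⟨b, rfl⟩
  have h1 : Fintype.card G.Arr ≤ G.underlying.edgeFinset.card := by
    rw [← Finset.card_univ]
    refine Finset.card_le_card_of_injOn (fun b => s(G.tail b, G.head b)) ?_ ?_
    · intro b _
      rw [Finset.mem_coe, SimpleGraph.mem_edgeFinset, SimpleGraph.mem_edgeSet]
      exact (SimpleGraph.fromRel_adj _ _ _).2 ⟨hG.no_loop b, Or.inl ⟨b, rfl, rfl⟩⟩
    · intro a _ b _ hab
      exact hG.no_multi a b hab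
  have h2 : Fintype.card {y // y ≠ r} = Fintype.card G.Vert - 1 := Set.card_ne_eq r
  have hbij : Function.Bijective f :=
    (Fintype.bijective_iff_surjective_and_card f).2
      ⟨hf, le_antisymm (by omega) (Fintype.card_le_of_surjective f hf)⟩
  intro a b hab
  exact hbij.1 (Subtype.ext hab)

/-- Finiteness makes the acyclic relation well founded in this direction too, which permits
induction from the root upwards. -/
theorem swap_pred_wf (Q : DirGraph.{u, v}) [Q.IsRootedTree] :
    WellFounded (Function.swap Q.Pred) := by
  have hwf : WellFounded (Relation.TransGen Q.Pred) := Q.pred_wf.transGen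
  have : Std.Irrefl (Function.swap (Relation.TransGen Q.Pred)) :=
    ⟨fun x h => hwf.irrefl.irrefl x h⟩
  have : IsTrans _ (Function.swap (Relation.TransGen Q.Pred)) :=
    ⟨fun _ _ _ h1 h2 => Relation.TransGen.trans h2 h1⟩
  have : WellFounded (Function.swap (Relation.TransGen Q.Pred)) :=
    Finite.wellFounded_of_trans_of_irrefl _
  exact Subrelation.wf (r := Function.swap (Relation.TransGen Q.Pred))
    (fun h => Relation.TransGen.single h) this

variable [Q.IsRootedTree]

theorem swap_pred_wf_of_hom (c : Hom G Q) : WellFounded (Function.swap G.Pred) := by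
  refine Subrelation.wf ?_ (InvImage.wf c.vert Q.swap_pred_wf)
  rintro _ _ ⟨a, rfl, rfl⟩
  exact ⟨c.arr a, c.tail_arr a, c.head_arr a⟩

/-- In an arborescence over `Q`, properties may be proved by going from the root upwards. -/
theorem IsArborescence.induction {r : G.Vert} (hG : G.IsArborescence r) (c : Hom G Q)
    {motive : G.Vert → Prop} (root : motive r)
    (step : ∀ b, motive (G.head b) → motive (G.tail b)) (y : G.Vert) : motive y := by
  induction y using (swap_pred_wf_of_hom c).induction with
  | h y ih =>
    by_cases hy : y = r
    · exact hy ▸ root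
    · obtain ⟨b, rfl⟩ := hG.exists_tail y hy
      exact step b (ih _ ⟨b, rfl, rfl⟩)

theorem IsArborescence.vert_reflTransGen {r : G.Vert} (hG : G.IsArborescence r) (c : Hom G Q)
    (y : G.Vert) : Relation.ReflTransGen Q.Pred (c.vert y) (c.vert r) := by
  induction y using hG.induction c with
  | root => exact .refl
  | step b ih => exact .head ⟨c.arr b, c.tail_arr b, c.head_arr b⟩ ih

theorem eq_of_reflTransGen {x y : Q.Vert} (h1 : Relation.ReflTransGen Q.Pred x y)
    (h2 : Relation.ReflTransGen Q.Pred y x) : x = y := by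
  rcases Relation.reflTransGen_iff_eq_or_transGen.1 h1 with h | h
  · exact h.symm
  · exact absurd (h.trans_left h2) (Q.pred_wf.transGen.irrefl.irrefl x)

/-- The root of an arborescence over `Q` is the only vertex over its image. -/
theorem IsArborescence.eq_root {r : G.Vert} (hG : G.IsArborescence r) (c : Hom G Q)
    {y : G.Vert} (h : c.vert y = c.vert r) : y = r := by
  by_contra hy
  obtain ⟨b, rfl⟩ := hG.exists_tail y hy
  have h1 : Relation.TransGen Q.Pred (c.vert (G.tail b)) (c.vert r) :=
    .head' ⟨c.arr b, c.tail_arr b, c.head_arr b⟩ (hG.vert_reflTransGen c _)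
  rw [h] at h1
  exact Q.pred_wf.transGen.irrefl.irrefl _ h1

/-- Distinct arrows over the same arrow of `Q` with the same head have tails of incomparable
shapes. -/
def IsThin (c : Hom G Q) : Prop :=
  ∀ b b', G.head b = G.head b' → c.arr b = c.arr b' →
    shape c (G.tail b) ≤ shape c (G.tail b') → b = b'

/-- Vertices of two arborescences whose paths to the roots run through the same shapes. -/
inductive Matches (c : Hom G Q) (d : Hom H Q) (r : G.Vert) (s : H.Vert) :
    G.Vert → H.Vert → Prop
  | root : Matches c d r s r s
  | step (b b') : Matches c d r s (G.head b) (H.head b') → c.arr b = d.arr b' →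
      shape c (G.tail b) = shape d (H.tail b') → Matches c d r s (G.tail b) (H.tail b')

variable {c : Hom G Q} {d : Hom H Q} {r : G.Vert} {s : H.Vert}

theorem Matches.symm {y : G.Vert} {z : H.Vert} (h : Matches c d r s y z) :
    Matches d c s r z y := by
  induction h with
  | root => exact .root
  | step b b' _ e1 e2 ih => exact .step _ _ ih e1.symm e2.symm

theorem Matches.shape_eq (hrs : shape c r = shape d s) {y : G.Vert} {z : H.Vert}
    (h : Matches c d r s y z) : shape c y = shape d z := by
  cases h with
  | root => exact hrs
  | step b b' _ e1 e2 => exact e2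

theorem matches_tail (hG : G.IsArborescence r) {b : G.Arr} {z : H.Vert}
    (h : Matches c d r s (G.tail b) z) :
    ∃ b', H.tail b' = z ∧ c.arr b = d.arr b' ∧ shape c (G.tail b) = shape d (H.tail b') ∧
      Matches c d r s (G.head b) (H.head b') := by
  generalize hy : G.tail b = y at h
  cases h with
  | root => exact absurd hy (hG.tail_ne b)
  | step b1 b' h e1 e2 =>
    obtain rfl := hG.tail_injective hy
    exact ⟨b', rfl, e1, e2, h⟩

theorem matches_root (hG : G.IsArborescence r) {z : H.Vert} (h : Matches c d r s r z) :
    z = s := by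
  generalize hy : r = y at h
  cases h with
  | root => rfl
  | step b1 b' h e1 e2 => exact absurd hy.symm (hG.tail_ne b1)

theorem Matches.unique (hG : G.IsArborescence r) (hd : IsThin d) {y : G.Vert} {z z' : H.Vert}
    (h : Matches c d r s y z) (h' : Matches c d r s y z') : z = z' := by
  induction y using hG.induction c generalizing z z' with
  | root => rw [matches_root hG h, matches_root hG h']
  | step b ih =>
    obtain ⟨b1, rfl, e1, f1, h1⟩ := matches_tail hG h
    obtain ⟨b2, rfl, e2, f2, h2⟩ := matches_tail hG h'
    rw [hd b1 b2 (ih h1 h2) (e1.symm.trans e2) (f1.symm.trans f2).le]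

/-- Simulating `b` by some `b'` and `b'` back by some `b2` gives siblings `b`, `b2` with comparable
shapes. Thinness of `c` yields `b = b2`, so the shapes at `b` and `b'` agree. -/
theorem exists_matches (hG : G.IsArborescence r) (hc : IsThin c)
    (hrs : shape c r = shape d s) (y : G.Vert) : ∃ z, Matches c d r s y z := by
  induction y using hG.induction c with
  | root => exact ⟨s, .root⟩
  | step b ih =>
    obtain ⟨z, hz⟩ := ih
    have hs := hz.shape_eq hrs
    obtain ⟨b', rfl, e, hle⟩ := (shape_le_shape_iff.1 hs.le).2 b rfl
    obtain ⟨b2, hb2, e2, hle2⟩ := (shape_le_shape_iff.1 hs.ge).2 b' rfl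
    obtain rfl := hc b b2 hb2.symm (e.symm.trans e2.symm) (hle.trans hle2)
    exact ⟨_, .step _ _ hz e.symm (le_antisymm hle hle2)⟩

/-- Thin arborescences over `Q` are determined by the shapes of their roots. -/
theorem nonempty_isoOver (hG : G.IsArborescence r) (hH : H.IsArborescence s) (hc : IsThin c)
    (hd : IsThin d) (hrs : shape c r = shape d s) : Nonempty (IsoOver c d) := by
  choose f hf using exists_matches hG hc hrs
  choose g hg using exists_matches hH hd hrs.symm
  have hgf : ∀ y, g (f y) = y := fun y => (hg (f y)).unique hH hc (hf y).symm
  have hfg : ∀ z, f (g z) = z := fun z => (hf (g z)).unique hG hd (hg z).symm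
  have hF : ∀ b, ∃ b', H.tail b' = f (G.tail b) ∧ H.head b' = f (G.head b) ∧
      d.arr b' = c.arr b := by
    intro b
    obtain ⟨b', h1, h2, -, h3⟩ := matches_tail hG (hf (G.tail b))
    exact ⟨b', h1, h3.unique hG hd (hf _), h2.symm⟩
  have hF' : ∀ b', ∃ b, G.tail b = g (H.tail b') := by
    intro b
    obtain ⟨b', h1, -⟩ := matches_tail hH (hg (H.tail b))
    exact ⟨b', h1⟩
  choose F hF1 hF2 hF3 using hF
  have hbij : Function.Bijective F := by
    constructor
    · intro b b' h
      apply hG.tail_injective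
      rw [← hgf (G.tail b), ← hF1, h, hF1, hgf]
    · intro b'
      obtain ⟨b, hb⟩ := hF' b'
      exact ⟨b, hH.tail_injective (by rw [hF1, hb, hfg])⟩
  exact ⟨{
    vert := ⟨f, g, hgf, hfg⟩
    arr := Equiv.ofBijective F hbij
    tail_arr := hF1
    head_arr := hF2
    over_vert := fun y => (congrArg Sigma.fst ((hf y).shape_eq hrs)).symm
    over_arr := hF3 }⟩

theorem IsThin.of_isoOver (e : IsoOver c d) (hd : IsThin d) : IsThin c := by
  have hs : ∀ y, shape d (e.vert y) = shape c y :=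
    shape_eq_of_hom e.vert e.arr e.over_vert e.over_arr e.tail_arr e.head_arr
      fun y b' hb' => ⟨e.arr.symm b', e.vert.injective (by rw [← e.head_arr]; simpa using hb'),
        by simp⟩
  intro b b' h1 h2 h3
  refine e.arr.injective (hd _ _ ?_ ?_ ?_)
  · rw [e.head_arr, e.head_arr, h1]
  · rw [e.over_arr, e.over_arr, h2]
  · rw [e.tail_arr, e.tail_arr, hs, hs]; exact h3

end Arborescence

/-! ### The quivers `Q_M` are exactly the thin arborescences -/

section Graft

variable {Q : DirGraph.{u, v}} {x : Q.Vert} {ι : Type v} {a : ι → Q.In x}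
  {P : ∀ i, PointedOver Q (Q.tail (a i))}

theorem IsArborescence.graft (h : ∀ i, (P i).G.IsArborescence (P i).root) :
    (graft a P).G.IsArborescence (graft a P).root where
  tail_injective := by
    rintro ⟨i, _ | b⟩ ⟨j, _ | b'⟩ e
    · have e : some (⟨i, (P i).root⟩ : Σ i, (P i).G.Vert) = some ⟨j, (P j).root⟩ := e
      obtain ⟨rfl, -⟩ := Sigma.mk.inj (Option.some.inj e)
      rfl
    · have e : some (⟨i, (P i).root⟩ : Σ i, (P i).G.Vert) = some ⟨j, (P j).G.tail b'⟩ := e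
      obtain ⟨rfl, e⟩ := Sigma.mk.inj (Option.some.inj e)
      exact absurd (eq_of_heq e).symm ((h i).tail_ne b')
    · have e : some (⟨i, (P i).G.tail b⟩ : Σ i, (P i).G.Vert) = some ⟨j, (P j).root⟩ := e
      obtain ⟨rfl, e⟩ := Sigma.mk.inj (Option.some.inj e)
      exact absurd (eq_of_heq e) ((h i).tail_ne b)
    · have e : some (⟨i, (P i).G.tail b⟩ : Σ i, (P i).G.Vert) = some ⟨j, (P j).G.tail b'⟩ := e
      obtain ⟨rfl, e⟩ := Sigma.mk.inj (Option.some.inj e)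
      rw [(h i).tail_injective (eq_of_heq e)]
  tail_ne := by
    rintro ⟨i, _ | b⟩ e <;> exact Option.some_ne_none _ e
  exists_tail := by
    rintro (_ | ⟨i, y⟩) hy
    · exact absurd rfl hy
    · by_cases hr : y = (P i).root
      · subst hr
        exact ⟨⟨i, none⟩, rfl⟩
      · obtain ⟨b, rfl⟩ := (h i).exists_tail y hr
        exact ⟨⟨i, some b⟩, rfl⟩

variable [Q.IsRootedTree]

/-- Grafting adds arrows only into the new root, so nothing above an old vertex changes. -/
theorem shape_graft (i : ι) (y : (P i).G.Vert) :
    shape (graft a P).c (some ⟨i, y⟩) = shape (P i).c y := by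
  refine shape_eq_of_hom (c := (P i).c) (d := (graft a P).c) (fun y => some ⟨i, y⟩)
    (fun b => ⟨i, some b⟩) (fun _ => rfl) (fun _ => rfl) (fun _ => rfl) (fun _ => rfl) ?_ y
  rintro y ⟨j, _ | b⟩ hb
  · exact absurd hb.symm (Option.some_ne_none _)
  · have hb : some (⟨j, (P j).G.head b⟩ : Σ i, (P i).G.Vert) = some ⟨i, y⟩ := hb
    obtain ⟨rfl, e⟩ := Sigma.mk.inj (Option.some.inj hb)
    exact ⟨b, eq_of_heq e, rfl⟩

theorem IsThin.graft (h : ∀ i, IsThin (P i).c)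
    (hroot : ∀ i j, (a i).1 = (a j).1 →
      shape (P i).c (P i).root ≤ shape (P j).c (P j).root → i = j) :
    IsThin (graft a P).c := by
  rintro ⟨i, _ | b⟩ ⟨j, _ | b'⟩ h1 h2 h3
  · have h3 : shape (DirGraph.graft a P).c (some ⟨i, (P i).root⟩) ≤
      shape (DirGraph.graft a P).c (some ⟨j, (P j).root⟩) := h3
    rw [shape_graft, shape_graft] at h3
    obtain rfl := hroot i j h2 h3
    rfl
  · exact absurd h1.symm (Option.some_ne_none _)
  · exact absurd h1 (Option.some_ne_none _)
  · have h1 : some (⟨i, (P i).G.head b⟩ : Σ i, (P i).G.Vert) = some ⟨j, (P j).G.head b'⟩ := h1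
    obtain ⟨rfl, e⟩ := Sigma.mk.inj (Option.some.inj h1)
    have h3 : shape (DirGraph.graft a P).c (some ⟨i, (P i).G.tail b⟩) ≤
      shape (DirGraph.graft a P).c (some ⟨i, (P i).G.tail b'⟩) := h3
    rw [shape_graft, shape_graft] at h3
    rw [h i b b' (eq_of_heq e) h2 h3]

/-- One induction serves all three claims: thinness at the new root needs the root shapes of the
branches. These are the maximal elements of the ideals, hence incomparable. -/
theorem redAux_spec (x : Q.Vert) (h : Acc Q.Pred x) (M : Q.latAux x h) :
    (Q.redAux x h M).G.IsArborescence (Q.redAux x h M).root ∧ IsThin (Q.redAux x h M).c ∧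
      shapeAux (Q.redAux x h M).c x h ⟨(Q.redAux x h M).root, (Q.redAux x h M).c_root⟩ = M := by
  induction h with
  | intro x hx ih =>
    let N : ∀ a : Q.In x, LowerSet (Q.latAux (Q.tail a) (hx _ ⟨a.1, rfl, a.2⟩)) := M
    let ι := Σ a : Q.In x, {S // Maximal (· ∈ N a) S}
    let P : ∀ i : ι, PointedOver Q (Q.tail i.1) := fun i => Q.redAux (Q.tail i.1) _ i.2.1
    have hP := fun i : ι => ih (Q.tail i.1) ⟨i.1.1, rfl, i.1.2⟩ i.2.1
    let R : PointedOver Q x := graft (ι := ι) (fun i => i.1) P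
    change R.G.IsArborescence R.root ∧ IsThin R.c ∧
      shapeAux R.c x (Acc.intro x hx) ⟨R.root, R.c_root⟩ = M
    refine ⟨IsArborescence.graft fun i => (hP i).1, IsThin.graft (fun i => (hP i).2.1) ?_, ?_⟩
    · rintro ⟨a, S, hS⟩ ⟨a', S', hS'⟩ haa hle
      obtain rfl : a = a' := Subtype.ext haa
      rw [shape_le_shape_iff_shapeAux (hx _ ⟨a.1, rfl, a.2⟩) (P ⟨a, S, hS⟩).c_root
        (P ⟨a, S', hS'⟩).c_root] at hle
      have hle : S ≤ S' := (hP ⟨a, S, hS⟩).2.2.ge.trans (hle.trans (hP ⟨a, S', hS'⟩).2.2.le)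
      obtain rfl : S = S' := le_antisymm hle (hS.2 hS'.1 hle)
      rfl
    · have hshape : ∀ (i : ι) (h1), shapeAux R.c (Q.tail i.1) (hx _ ⟨i.1.1, rfl, i.1.2⟩)
            ⟨some ⟨i, (P i).root⟩, h1⟩ = i.2.1 := by
        intro i h1
        have := shape_graft (a := fun i : ι => i.1) i (P i).root
        refine Eq.trans (le_antisymm ?_ ?_) (hP i).2.2
        · exact (shape_le_shape_iff_shapeAux _ _ _).1 this.le
        · exact (shape_le_shape_iff_shapeAux _ _ _).1 this.ge
      suffices h : (fun a => lowerClosure {S | ∃ (b : R.G.Arr) (hb : R.c.arr b = a.1),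
          R.G.head b = R.root ∧ shapeAux R.c (Q.tail a) (hx _ ⟨a.1, rfl, a.2⟩)
            ⟨R.G.tail b, by rw [← R.c.tail_arr, hb]⟩ = S} :
          ∀ a : Q.In x, LowerSet (Q.latAux (Q.tail a) (hx _ ⟨a.1, rfl, a.2⟩))) = N from h
      funext a
      apply le_antisymm
      · rw [lowerClosure_le]
        rintro S ⟨⟨⟨a', S', hS'⟩, _ | b⟩, hb, h1, h2⟩
        · obtain rfl : a' = a := Subtype.ext hb
          rw [← h2]
          have := hshape ⟨a', S', hS'⟩ (P ⟨a', S', hS'⟩).c_root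
          exact this.symm ▸ hS'.1
        · exact absurd h1 (Option.some_ne_none _)
      -- In a finite poset each element of an ideal lies below a maximal one, so these generate the
      -- ideal.
      · intro S hS
        have := Q.finite_latAux _ (hx _ ⟨a.1, rfl, a.2⟩)
        obtain ⟨S', hSS', hS'⟩ := (Set.toFinite {T | T ∈ N a}).exists_le_maximal hS
        exact ⟨S', ⟨⟨⟨a, S', hS'⟩, none⟩, rfl, rfl, hshape ⟨a, S', hS'⟩ _⟩, hSS'⟩

theorem red_isArborescence (M : Q.L) : (red M).IsArborescence (Q.redAux M.1 _ M.2).root :=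
  (redAux_spec _ _ _).1

theorem redMap_isThin (M : Q.L) : IsThin (redMap M) :=
  (redAux_spec _ _ _).2.1

theorem shape_redMap_root (M : Q.L) : shape (redMap M) (Q.redAux M.1 _ M.2).root = M := by
  rw [shape_eq _ (Q.redAux M.1 _ M.2).c_root, (redAux_spec _ _ _).2.2]

theorem isReduced_iff_isThin {G : DirGraph.{u', v'}} {r : G.Vert} (hG : G.IsArborescence r)
    (c : Hom G Q) : IsReduced c ↔ IsThin c := by
  constructor
  · rintro ⟨M, ⟨e⟩⟩
    exact (redMap_isThin M).of_isoOver e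
  · intro hc
    exact ⟨shape c r, nonempty_isoOver hG (red_isArborescence _) hc (redMap_isThin _)
      (shape_redMap_root _).symm⟩

end Graft

end DirGraph

namespace DirGraph

/-! ### Folding an arborescence that is not thin -/

section Retraction

variable {Q : DirGraph.{u, v}} [Q.IsRootedTree] {G : DirGraph.{u', v'}} {r : G.Vert}

theorem IsArborescence.exists_rec (hG : G.IsArborescence r) (c : Hom G Q) {α : Type*} (a : α)
    (step : G.Arr → α → α) :
    ∃ f : G.Vert → α, f r = a ∧ ∀ b, f (G.tail b) = step b (f (G.head b)) := by
  classical
  let F : ∀ y : G.Vert, (∀ z, Function.swap G.Pred z y → α) → α := fun y ih =>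
    if h : y = r then a else
      step (hG.exists_tail y h).choose (ih _ ⟨_, (hG.exists_tail y h).choose_spec, rfl⟩)
  refine ⟨(swap_pred_wf_of_hom c).fix F, ?_, fun b => ?_⟩
  · rw [WellFounded.fix_eq]
    simp [F]
  · rw [WellFounded.fix_eq]
    have hb : (hG.exists_tail (G.tail b) (hG.tail_ne b)).choose = b :=
      hG.tail_injective (hG.exists_tail (G.tail b) (hG.tail_ne b)).choose_spec
    simp only [F, hG.tail_ne b, dite_false]
    rw [hb]

/-- An arborescence over `Q` which is not thin retracts onto a proper part. -/
theorem IsArborescence.exists_retraction (hG : G.IsArborescence r) {c : Hom G Q}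
    (hc : ¬ IsThin c) :
    ∃ f : G.Vert → G.Vert, (∀ y, c.vert (f y) = c.vert y) ∧ (∀ y, f (f y) = f y) ∧ f r = r ∧
      (∀ b, ∃ b', G.tail b' = f (G.tail b) ∧ G.head b' = f (G.head b) ∧ c.arr b' = c.arr b) ∧
      ∃ y, f y ≠ y := by
  classical
  simp only [IsThin, not_forall] at hc
  obtain ⟨b1, b2, hhead, harr, hle, hne⟩ := hc
  -- Move `b1` onto its sibling `b2`, leave an arrow alone while its head is fixed, and afterwards
  -- follow a simulating arrow. The final `else z` is never reached, because `f` only enlarges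
  -- shapes.
  let step : G.Arr → G.Vert → G.Vert := fun b z =>
    if b = b1 then G.tail b2 else if z = G.head b then G.tail b else
      if h : ∃ b', G.head b' = z ∧ c.arr b' = c.arr b ∧
        shape c (G.tail b) ≤ shape c (G.tail b') then G.tail h.choose else z
  obtain ⟨f, hfr, hf⟩ := hG.exists_rec c r step
  have hf1 : f (G.tail b1) = G.tail b2 := by rw [hf]; simp [step]
  have hf2 : ∀ b, b ≠ b1 → f (G.head b) = G.head b → f (G.tail b) = G.tail b := by
    intro b hb h
    rw [hf]; simp [step, hb, h]
  have hf3 : ∀ b, b ≠ b1 → f (G.head b) ≠ G.head b →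
      shape c (G.head b) ≤ shape c (f (G.head b)) → ∃ b', f (G.tail b) = G.tail b' ∧
        G.head b' = f (G.head b) ∧ c.arr b' = c.arr b ∧
        shape c (G.tail b) ≤ shape c (G.tail b') := by
    intro b hb h hs
    have hex := (shape_le_shape_iff.1 hs).2 b rfl
    refine ⟨hex.choose, ?_, hex.choose_spec⟩
    rw [hf]
    simp only [step, hb, if_false, h]
    rw [dif_pos hex]
  have hshape : ∀ y, shape c y ≤ shape c (f y) := by
    intro y
    induction y using hG.induction c with
    | root => rw [hfr]
    | step b ih =>
      by_cases hb : b = b1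
      · subst hb; rw [hf1]; exact hle
      · by_cases h : f (G.head b) = G.head b
        · rw [hf2 b hb h]
        · obtain ⟨b', e, -, -, h'⟩ := hf3 b hb h ih
          rw [e]; exact h'
  -- Only vertices above `G.tail b1` move, and their images lie above `G.tail b2`.
  have hdich : ∀ y, f y = y ∨ (Relation.ReflTransGen G.Pred y (G.tail b1) ∧
      Relation.ReflTransGen G.Pred (f y) (G.tail b2)) := by
    intro y
    induction y using hG.induction c with
    | root => exact .inl hfr
    | step b ih =>
      by_cases hb : b = b1
      · subst hb; rw [hf1]; exact .inr ⟨.refl, .refl⟩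
      · by_cases h : f (G.head b) = G.head b
        · exact .inl (hf2 b hb h)
        · obtain ⟨h1, h2⟩ := ih.resolve_left h
          obtain ⟨b', e, h3, -, -⟩ := hf3 b hb h (hshape _)
          rw [e]
          exact .inr ⟨.head ⟨b, rfl, rfl⟩ h1, .head ⟨b', rfl, h3⟩ h2⟩
  have hirr : ∀ y, ¬ Relation.TransGen G.Pred y y :=
    fun y => (pred_wf_of_hom c).transGen.irrefl.irrefl y
  have hhead1 : f (G.head b1) = G.head b1 :=
    (hdich _).resolve_right fun h => hirr _ (.tail' h.1 ⟨b1, rfl, rfl⟩)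
  have huniq : Relator.RightUnique G.Pred := by
    rintro _ _ _ ⟨a, rfl, rfl⟩ ⟨a', h, rfl⟩
    rw [hG.tail_injective h]
  have hincomp : ∀ p q : G.Arr, p ≠ q → G.head p = G.head q →
      ¬ Relation.ReflTransGen G.Pred (G.tail p) (G.tail q) := by
    intro p q hpq hh h
    rcases h.cases_head with h' | ⟨z, ⟨a, ha, rfl⟩, h'⟩
    · exact hpq (hG.tail_injective h')
    · obtain rfl := hG.tail_injective ha
      exact hirr _ (.head' ⟨q, rfl, hh.symm⟩ h')
  refine ⟨f, fun y => (vert_eq_of_shape_le (hshape y)).symm, fun y => ?_, hfr, fun b => ?_,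
    G.tail b1, ?_⟩
  · rcases hdich y with h | ⟨-, h⟩
    · rw [h, h]
    -- If `f y` moved, it would lie above both `G.tail b1` and `G.tail b2`; but a vertex has only
    -- one path to the root, so one sibling's tail would lie above the other's.
    · refine (hdich (f y)).resolve_right fun h' => ?_
      rcases h.total_of_right_unique huniq h'.1 with h'' | h''
      · exact hincomp b2 b1 (Ne.symm hne) hhead.symm h''
      · exact hincomp b1 b2 hne hhead h''
  · by_cases hb : b = b1
    · subst hb
      exact ⟨b2, hf1.symm, by rw [hhead1, hhead], harr.symm⟩
    · by_cases h : f (G.head b) = G.head b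
      · exact ⟨b, (hf2 b hb h).symm, h.symm, rfl⟩
      · obtain ⟨b', e, h3, h4, -⟩ := hf3 b hb h (hshape _)
        exact ⟨b', e.symm, h3, h4⟩
  · rw [hf1]
    exact fun h => hne (hG.tail_injective h.symm)

end Retraction

end DirGraph

namespace DirGraph

/-! ### Direct sum decompositions and idempotents -/

namespace Rep

variable {K : Type k} [Field K] {Q : DirGraph.{u, v}}

/-- A family of linear maps commuting with the maps of two representations. -/
def Intertwines {V : Rep.{u, v, k, w} K Q} {W : Rep.{u, v, k, w'} K Q}
    (φ : ∀ x, V.space x →ₗ[K] W.space x) : Prop :=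
  ∀ (a : Q.Arr) (s : V.space (Q.tail a)), φ (Q.head a) (V.map a s) = W.map a (φ (Q.tail a) s)

universe w''

/-- The inverse of an isomorphism of representations. -/
def Iso.symm {V : Rep.{u, v, k, w} K Q} {W : Rep.{u, v, k, w'} K Q} (e : V.Iso W) :
    W.Iso V where
  equiv x := (e.equiv x).symm
  comm a s := by
    rw [LinearEquiv.symm_apply_eq, e.comm, LinearEquiv.apply_symm_apply]

/-- The composition of isomorphisms of representations. -/
def Iso.trans {V : Rep.{u, v, k, w} K Q} {W : Rep.{u, v, k, w'} K Q}
    {U : Rep.{u, v, k, w''} K Q} (e : V.Iso W) (f : W.Iso U) : V.Iso U where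
  equiv x := (e.equiv x).trans (f.equiv x)
  comm a s := by simp [e.comm, f.comm]

theorem Iso.indecomposable {V W : Rep.{u, v, k, w} K Q} (e : V.Iso W)
    (h : V.Indecomposable) : W.Indecomposable := by
  refine ⟨fun h0 => h.1 fun x => ?_, fun U U' ⟨f⟩ => h.2 U U' ⟨e.trans f⟩⟩
  have := h0 x
  exact (e.equiv x).toEquiv.subsingleton

theorem Iso.indecomposable_iff {V W : Rep.{u, v, k, w} K Q} (e : V.Iso W) :
    V.Indecomposable ↔ W.Indecomposable :=
  ⟨e.indecomposable, e.symm.indecomposable⟩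

/-- A nonzero representation is indecomposable if of any two endomorphisms with sum the identity
one is injective. -/
theorem indecomposable_of_injective_or {V : Rep.{u, v, k, w} K Q} (h0 : ¬ V.IsZero)
    (h : ∀ φ ψ : ∀ x, V.space x →ₗ[K] V.space x, Intertwines φ → Intertwines ψ →
      (∀ x s, φ x s + ψ x s = s) →
        (∀ x, Function.Injective (φ x)) ∨ ∀ x, Function.Injective (ψ x)) :
    V.Indecomposable := by
  refine ⟨h0, fun U W ⟨e⟩ => ?_⟩
  let g : ∀ x, V.space x ≃ₗ[K] U.space x × W.space x := e.equiv
  have hg : ∀ a s, g (Q.head a) (V.map a s) =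
      (U.map a (g (Q.tail a) s).1, W.map a (g (Q.tail a) s).2) := e.comm
  let p : ∀ x, V.space x →ₗ[K] V.space x := fun x =>
    (g x).symm.toLinearMap ∘ₗ (LinearMap.inl K _ _ ∘ₗ LinearMap.fst K _ _) ∘ₗ (g x).toLinearMap
  let q : ∀ x, V.space x →ₗ[K] V.space x := fun x =>
    (g x).symm.toLinearMap ∘ₗ (LinearMap.inr K _ _ ∘ₗ LinearMap.snd K _ _) ∘ₗ (g x).toLinearMap
  have hp : ∀ x s, g x (p x s) = ((g x s).1, 0) := fun x s => by simp [p]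
  have hq : ∀ x s, g x (q x s) = (0, (g x s).2) := fun x s => by simp [q]
  have hpi : Intertwines p := fun a s => (g _).injective (by rw [hp, hg, hg, hp, map_zero])
  have hqi : Intertwines q := fun a s => (g _).injective (by rw [hq, hg, hg, hq, map_zero])
  have hpq : ∀ x s, p x s + q x s = s := fun x s =>
    (g x).injective (by rw [map_add, hp, hq]; simp)
  rcases h p q hpi hqi hpq with hi | hi
  -- `p` kills the summand `W`, so injectivity of `p` forces `W` to be zero.
  · refine .inr fun x => subsingleton_of_forall_eq 0 fun t => ?_
    have h1 : p x ((g x).symm (0, t)) = p x 0 :=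
      (g x).injective (by rw [hp]; simp)
    simpa using congrArg (g x) (hi x h1)
  · refine .inl fun x => subsingleton_of_forall_eq 0 fun t => ?_
    have h1 : q x ((g x).symm (t, 0)) = q x 0 :=
      (g x).injective (by rw [hq]; simp)
    simpa using congrArg (g x) (hi x h1)

/-- An idempotent endomorphism of an indecomposable representation is zero or the identity. -/
theorem Indecomposable.eq_zero_or_eq_id {V : Rep.{u, v, k, w} K Q} (hV : V.Indecomposable)
    (e : ∀ x, V.space x →ₗ[K] V.space x) (he : Intertwines e)
    (hee : ∀ x s, e x (e x s) = e x s) : (∀ x, e x = 0) ∨ ∀ x, e x = LinearMap.id := by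
  let U : Rep.{u, v, k, w} K Q :=
    { space x := LinearMap.range (e x)
      map a := (V.map a).restrict (by
        rintro _ ⟨s, rfl⟩
        exact ⟨V.map a s, he a s⟩) }
  let W : Rep.{u, v, k, w} K Q :=
    { space x := LinearMap.ker (e x)
      map a := (V.map a).restrict (by
        intro s hs
        rw [LinearMap.mem_ker] at hs ⊢
        rw [he, hs, map_zero]) }
  have hc : ∀ x, IsCompl (LinearMap.range (e x)) (LinearMap.ker (e x)) := fun x =>
    LinearMap.IsIdempotentElem.isCompl (f := e x) (LinearMap.ext (hee x))
  let f : (U.sum W).Iso V :=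
    { equiv x := Submodule.prodEquivOfIsCompl _ _ (hc x)
      comm a s := by
        change ((V.map a s.1.1 : V.space _) + V.map a s.2.1) = V.map a (s.1.1 + s.2.1)
        rw [map_add] }
  rcases hV.2 U W ⟨f.symm⟩ with h | h
  · refine .inl fun x => LinearMap.ext fun s => ?_
    have := h x
    exact congrArg Subtype.val (Subsingleton.elim (⟨e x s, s, rfl⟩ : LinearMap.range (e x)) 0)
  · refine .inr fun x => LinearMap.ext fun s => ?_
    have := h x
    have hs : s - e x s ∈ LinearMap.ker (e x) := by simp [LinearMap.mem_ker, hee]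
    have := congrArg Subtype.val (Subsingleton.elim (⟨_, hs⟩ : LinearMap.ker (e x)) 0)
    exact (sub_eq_zero.1 this).symm

end Rep

end DirGraph

namespace DirGraph

/-! ### Endomorphisms in the basis of vertices -/

section Linearization

variable (K : Type k) [Field K] {Q : DirGraph.{u, v}} {G : DirGraph.{u', v'}}
  {H : DirGraph.{w, w'}}

/-- The vector space with a basis given by the vertices over `x`. -/
abbrev FibreSpace (c : Hom G Q) (x : Q.Vert) : Type (max u' k) := {y : G.Vert // c.vert y = x} → K

open Classical in
/-- The linear map given by the arrows over `a`. -/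
noncomputable def fibreMap (c : Hom G Q) [Finite G.Arr] (a : Q.Arr) :
    FibreSpace K c (Q.tail a) →ₗ[K] FibreSpace K c (Q.head a) :=
  letI := Fintype.ofFinite G.Arr
  LinearMap.pi fun z => ∑ b : {b : G.Arr // c.arr b = a ∧ G.head b = z.1},
    LinearMap.proj ⟨G.tail b.1, by rw [← c.tail_arr, b.2.1]⟩

/-- The pushforward of the constant representation, in coordinates. -/
noncomputable def fibreRep (c : Hom G Q) [Finite G.Vert] [Finite G.Arr] :
    Rep.{u, v, k, max u' k} K Q where
  space x := FibreSpace K c x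
  map a := fibreMap K c a

variable {K}

open Classical in
theorem fibreMap_apply (c : Hom G Q) [Finite G.Arr] {a : Q.Arr}
    (s : FibreSpace K c (Q.tail a)) (z : {z // c.vert z = Q.head a}) :
    letI := Fintype.ofFinite G.Arr
    fibreMap K c a s z = ∑ b : {b : G.Arr // c.arr b = a ∧ G.head b = z.1},
      s ⟨G.tail b.1, by rw [← c.tail_arr, b.2.1]⟩ := by
  simp only [fibreMap, LinearMap.pi_apply, LinearMap.sum_apply, LinearMap.proj_apply]

theorem exists_of_fibreMap_apply_ne_zero {c : Hom G Q} [Finite G.Arr] {a : Q.Arr}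
    {s : FibreSpace K c (Q.tail a)} {z : {z // c.vert z = Q.head a}}
    (h : fibreMap K c a s z ≠ 0) :
    ∃ (b : G.Arr) (hb : c.arr b = a), G.head b = z.1 ∧
      s ⟨G.tail b, by rw [← c.tail_arr, hb]⟩ ≠ 0 := by
  classical
  rw [fibreMap_apply] at h
  obtain ⟨b, -, hb⟩ := Finset.exists_ne_zero_of_sum_ne_zero h
  exact ⟨b.1, b.2.1, b.2.2, hb⟩

/-- The no-cancellation criterion: a coordinate survives when `b` is the only sibling that can
contribute. -/
theorem fibreMap_apply_eq {c : Hom G Q} [Finite G.Arr] {a : Q.Arr}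
    {s : FibreSpace K c (Q.tail a)} (b : G.Arr) (hb : c.arr b = a)
    (h : ∀ (b' : G.Arr) (hb' : c.arr b' = a), G.head b' = G.head b →
      s ⟨G.tail b', by rw [← c.tail_arr, hb']⟩ ≠ 0 → b' = b) :
    fibreMap K c a s ⟨G.head b, by rw [← c.head_arr, hb]⟩ =
      s ⟨G.tail b, by rw [← c.tail_arr, hb]⟩ := by
  classical
  let _ := Fintype.ofFinite G.Arr
  rw [fibreMap_apply]
  refine Fintype.sum_eq_single (⟨b, hb, rfl⟩ : {b' // c.arr b' = a ∧ G.head b' = G.head b}) ?_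
  intro b' hb'
  by_contra h0
  exact hb' (Subtype.ext (h b'.1 b'.2.1 b'.2.2 h0))

variable [DecidableEq G.Vert]

theorem fibreMap_single {r : G.Vert} (hG : G.IsArborescence r) {c : Hom G Q} [Finite G.Arr]
    (b : G.Arr) {a : Q.Arr} (hb : c.arr b = a) :
    fibreMap K c a (Pi.single ⟨G.tail b, by rw [← c.tail_arr, hb]⟩ 1) =
      Pi.single ⟨G.head b, by rw [← c.head_arr, hb]⟩ 1 := by
  ext z
  by_cases hz : G.head b = z.1
  · obtain ⟨z, hz'⟩ := z
    dsimp only at hz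
    subst hz
    rw [fibreMap_apply_eq b hb, Pi.single_eq_same, Pi.single_eq_same]
    intro b' hb' _ hne
    by_contra hbb
    refine hne (Pi.single_eq_of_ne ?_ _)
    exact fun e => hbb (hG.tail_injective (congrArg Subtype.val e))
  · rw [Pi.single_eq_of_ne (fun e => hz (congrArg Subtype.val e).symm)]
    by_contra hne
    obtain ⟨b', hb', h1, h2⟩ := exists_of_fibreMap_apply_ne_zero hne
    refine h2 (Pi.single_eq_of_ne ?_ _)
    intro e
    rw [hG.tail_injective (congrArg Subtype.val e)] at h1
    exact hz h1

theorem fibreMap_single_root {r : G.Vert} (hG : G.IsArborescence r) {c : Hom G Q} [Finite G.Arr]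
    {a : Q.Arr} (hr : c.vert r = Q.tail a) :
    fibreMap K c a (Pi.single ⟨r, hr⟩ 1) = 0 := by
  ext z
  by_contra hne
  obtain ⟨b', hb', h1, h2⟩ := exists_of_fibreMap_apply_ne_zero hne
  exact h2 (Pi.single_eq_of_ne (fun e => hG.tail_ne b' (congrArg Subtype.val e)) _)

theorem exists_of_map_apply_ne_zero {c : Hom G Q} {d : Hom H Q} [Finite G.Vert] {x : Q.Vert}
    {φ : FibreSpace K c x →ₗ[K] FibreSpace K d x} {s : FibreSpace K c x} {z}
    (h : φ s z ≠ 0) : ∃ y, s y ≠ 0 ∧ φ (Pi.single y 1) z ≠ 0 := by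
  have := Fintype.ofFinite {y : G.Vert // c.vert y = x}
  rw [φ.pi_apply_eq_sum_univ, Finset.sum_apply] at h
  obtain ⟨y, -, hy⟩ := Finset.exists_ne_zero_of_sum_ne_zero h
  rw [Pi.smul_apply, smul_eq_mul] at hy
  refine ⟨y, left_ne_zero_of_mul hy, ?_⟩
  have : (Pi.single y 1 : FibreSpace K c x) = fun j => if y = j then 1 else 0 := by
    ext j
    simp [Pi.single_apply, eq_comm]
  rw [this]
  exact right_ne_zero_of_mul hy

theorem not_isZero_fibreRep {r : G.Vert} {c : Hom G Q} [Finite G.Vert] [Finite G.Arr] :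
    ¬ (fibreRep K c).IsZero := by
  intro h
  have h1 : Subsingleton (FibreSpace K c (c.vert r)) := h (c.vert r)
  have := congrFun (Subsingleton.elim (Pi.single ⟨r, rfl⟩ 1 : FibreSpace K c (c.vert r)) 0) ⟨r, rfl⟩
  simp at this

variable [Q.IsRootedTree] [Finite G.Arr] [Finite H.Arr]

/-- For an arrow `b` into `y` over `a`, the basis vector of `y` is the image of that of `G.tail b`.
After commuting with `φ`, the coefficient at `z` is a sum over arrows into `z` over `a`; a nonzero
term supplies the simulating arrow. -/
theorem shape_le_of_single_ne_zero {r : G.Vert} (hG : G.IsArborescence r) {c : Hom G Q}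
    {d : Hom H Q} {φ : ∀ x, FibreSpace K c x →ₗ[K] FibreSpace K d x}
    (hφ : ∀ a s, φ _ (fibreMap K c a s) = fibreMap K d a (φ _ s)) (x : Q.Vert)
    (y : {y // c.vert y = x}) (z : {z // d.vert z = x}) (h : φ x (Pi.single y 1) z ≠ 0) :
    shape c y.1 ≤ shape d z.1 := by
  induction x using Q.pred_wf.induction with
  | h x ih =>
    refine shape_le_shape_iff.2 ⟨y.2.trans z.2.symm, fun b hb => ?_⟩
    obtain ⟨y, hy⟩ := y
    dsimp only at hb
    subst hb
    obtain ⟨a, ha⟩ : ∃ a, c.arr b = a := ⟨_, rfl⟩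
    obtain rfl : Q.head a = x := by rw [← ha, c.head_arr, hy]
    rw [← fibreMap_single hG b ha, hφ] at h
    obtain ⟨b', hb', h1, h2⟩ := exists_of_fibreMap_apply_ne_zero h
    exact ⟨b', h1, hb'.trans ha.symm, ih _ ⟨a, rfl, rfl⟩ _ _ h2⟩

variable [Finite G.Vert]

theorem exists_shape_le_of_map_ne_zero {r : G.Vert} (hG : G.IsArborescence r) {c : Hom G Q}
    {d : Hom H Q} {φ : ∀ x, FibreSpace K c x →ₗ[K] FibreSpace K d x}
    (hφ : ∀ a s, φ _ (fibreMap K c a s) = fibreMap K d a (φ _ s)) {x : Q.Vert}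
    {s : FibreSpace K c x} {z : {z // d.vert z = x}} (h : φ x s z ≠ 0) :
    ∃ y, s y ≠ 0 ∧ shape c y.1 ≤ shape d z.1 := by
  obtain ⟨y, h1, h2⟩ := exists_of_map_apply_ne_zero h
  exact ⟨y, h1, shape_le_of_single_ne_zero hG hφ x y z h2⟩

/-- If an endomorphism of the representation attached to a thin arborescence does not kill the
root, then it maps no nonzero vector to one with disjoint support. -/
theorem IsThin.exists_map_apply_ne_zero {r : G.Vert} (hG : G.IsArborescence r) {c : Hom G Q}
    (hc : IsThin c) {φ : ∀ x, FibreSpace K c x →ₗ[K] FibreSpace K c x}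
    (hφ : ∀ a s, φ _ (fibreMap K c a s) = fibreMap K c a (φ _ s))
    (hr : φ (c.vert r) (Pi.single ⟨r, rfl⟩ 1) ⟨r, rfl⟩ ≠ 0) (x : Q.Vert)
    (t : FibreSpace K c x) (ht : t ≠ 0) : ∃ y, t y ≠ 0 ∧ φ x t y ≠ 0 := by
  classical
  induction x using Q.swap_pred_wf.induction with
  | h x ih =>
    -- The part of `t` of minimal shape is the one whose image under `φ` the rest of `t` cannot
    -- disturb at vertices of that same shape.
    obtain ⟨y0, hy0⟩ := (Set.toFinite {y | t y ≠ 0}).exists_minimalFor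
      (fun y => shape c y.1) _ (Function.ne_iff.1 ht)
    have hmin : ∀ y, t y ≠ 0 → shape c y.1 ≤ shape c y0.1 → shape c y.1 = shape c y0.1 :=
      fun y hy hle => le_antisymm hle (hy0.2 hy hle)
    by_cases hyr : y0.1 = r
    · obtain ⟨y, hy⟩ := y0
      dsimp only at hyr
      subst hyr
      subst hy
      refine ⟨⟨y, rfl⟩, hy0.1, ?_⟩
      have hts : t = t ⟨y, rfl⟩ • Pi.single ⟨y, rfl⟩ 1 := by
        ext z
        obtain rfl : z = ⟨y, rfl⟩ := Subtype.ext (hG.eq_root c z.2)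
        simp
      rw [hts, map_smul, Pi.smul_apply, smul_eq_mul]
      exact mul_ne_zero hy0.1 hr
    · obtain ⟨b0, hb0⟩ := hG.exists_tail _ hyr
      obtain ⟨y0, hy0'⟩ := y0
      dsimp only at hb0
      subst hb0
      obtain ⟨a, ha⟩ : ∃ a, c.arr b0 = a := ⟨_, rfl⟩
      obtain rfl : Q.tail a = x := by rw [← ha, c.tail_arr, hy0']
      let s : FibreSpace K c (Q.tail a) :=
        fun y => if shape c y.1 = shape c (G.tail b0) then t y else 0
      have hs : ∀ y, s y ≠ 0 → shape c y.1 = shape c (G.tail b0) ∧ t y ≠ 0 := by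
        intro y hy
        by_cases h : shape c y.1 = shape c (G.tail b0)
        · exact ⟨h, by simpa [s, h] using hy⟩
        · simp [s, h] at hy
      have hs0 : s ⟨G.tail b0, hy0'⟩ ≠ 0 := by
        simpa [s] using hy0.1
      -- The support of `s` has a single shape, so by thinness it contains at most one tail from
      -- each family of siblings over `a`, and nothing cancels.
      have hu : fibreMap K c a s ≠ 0 := by
        intro h0
        apply hs0
        have := fibreMap_apply_eq (s := s) b0 ha fun b' hb' h1 h2 =>
          hc _ _ h1 (hb'.trans ha.symm) (hs _ h2).1.le
        rw [h0] at this
        exact this.symm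
      obtain ⟨z, hz1, hz2⟩ := ih (Q.head a) ⟨a, rfl, rfl⟩ _ hu
      obtain ⟨b, hb, hbz, hsb⟩ := exists_of_fibreMap_apply_ne_zero hz1
      obtain ⟨z, hz⟩ := z
      dsimp only at hbz
      subst hbz
      have hsb' := hs _ hsb
      -- By triangularity `φ s` lives on shapes above that of `G.tail b`; thinness leaves `b` as the
      -- only contributing sibling.
      rw [hφ, fibreMap_apply_eq b hb] at hz2
      · refine ⟨_, hsb'.2, ?_⟩
        -- A contribution would come from the support of `t` with shape at most the minimal one,
        -- hence equal to it, where `t - s` vanishes.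
        have hsub : φ _ (t - s) ⟨G.tail b, by rw [← c.tail_arr, hb]⟩ = 0 := by
          by_contra hne
          obtain ⟨y, hy1, hy2⟩ := exists_shape_le_of_map_ne_zero hG hφ hne
          rw [hsb'.1] at hy2
          rw [Pi.sub_apply] at hy1
          by_cases hty : t y = 0
          · simp [s, hty] at hy1
          · simp [s, hmin y hty hy2] at hy1
        rw [map_sub, Pi.sub_apply, sub_eq_zero] at hsub
        rw [hsub]
        exact hz2
      · intro b' hb' h1 h2
        obtain ⟨y, hy1, hy2⟩ := exists_shape_le_of_map_ne_zero hG hφ h2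
        rw [(hs y hy1).1, ← hsb'.1] at hy2
        exact (hc b b' h1.symm (hb.trans hb'.symm) hy2).symm

theorem IsThin.indecomposable {r : G.Vert} (hG : G.IsArborescence r) {c : Hom G Q}
    (hc : IsThin c) : (fibreRep K c).Indecomposable := by
  have key : ∀ φ : ∀ x, FibreSpace K c x →ₗ[K] FibreSpace K c x,
      (∀ a s, φ _ (fibreMap K c a s) = fibreMap K c a (φ _ s)) →
      φ (c.vert r) (Pi.single ⟨r, rfl⟩ 1) ⟨r, rfl⟩ ≠ 0 → ∀ x, Function.Injective (φ x) := by
    intro φ hφ hr x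
    rw [injective_iff_map_eq_zero]
    intro t ht
    by_contra hne
    obtain ⟨y, -, hy⟩ := hc.exists_map_apply_ne_zero hG hφ hr x t hne
    exact hy (by rw [ht]; rfl)
  refine Rep.indecomposable_of_injective_or (not_isZero_fibreRep (r := r))
    fun φ ψ hφ hψ hsum => ?_
  by_cases hr : (show FibreSpace K c (c.vert r) from φ (c.vert r)
    (Pi.single ⟨r, rfl⟩ 1 : FibreSpace K c (c.vert r))) ⟨r, rfl⟩ = 0
  · refine .inr (key ψ hψ fun h => ?_)
    have := congrFun (hsum (c.vert r) (Pi.single ⟨r, rfl⟩ 1 : FibreSpace K c (c.vert r))) ⟨r, rfl⟩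
    refine one_ne_zero (α := K) ?_
    rw [← Pi.single_eq_same (M := fun _ => K) (⟨r, rfl⟩ : {y // c.vert y = c.vert r}) 1]
    refine this.symm.trans ?_
    exact (congrArg₂ (· + ·) hr h).trans (add_zero 0)
  · exact .inl (key φ hφ hr)

theorem isThin_of_indecomposable {r : G.Vert} (hG : G.IsArborescence r) {c : Hom G Q}
    (h : (fibreRep K c).Indecomposable) : IsThin c := by
  classical
  by_contra hc
  obtain ⟨f, hf, hff, hfr, hfb, y, hy⟩ := hG.exists_retraction hc
  obtain ⟨ρ, hρ⟩ := IsRootedTree.exists_isArborescence Q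
  let F : ∀ x, {y // c.vert y = x} → {y // c.vert y = x} := fun x y => ⟨f y.1, (hf _).trans y.2⟩
  have := fun x => Fintype.ofFinite {y // c.vert y = x}
  let e : ∀ x, FibreSpace K c x →ₗ[K] FibreSpace K c x := fun x =>
    Fintype.linearCombination K fun y => Pi.single (F x y) 1
  have he : ∀ x y, e x (Pi.single y 1) = Pi.single (F x y) 1 := fun x y => by
    simp [e, Fintype.linearCombination_apply_single]
  have hcomm : ∀ a, e _ ∘ₗ fibreMap K c a = fibreMap K c a ∘ₗ e _ := by
    refine fun a => LinearMap.pi_ext' fun p => LinearMap.ext_ring ?_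
    obtain ⟨p, hp⟩ := p
    simp only [LinearMap.comp_apply, LinearMap.coe_single, he]
    by_cases hpr : p = r
    · subst hpr
      have hF : F _ ⟨p, hp⟩ = ⟨p, hp⟩ := Subtype.ext hfr
      rw [hF, fibreMap_single_root hG, map_zero]
    · obtain ⟨b, rfl⟩ := hG.exists_tail p hpr
      -- An arrow of the rooted tree `Q` is determined by its tail, so no other arrow over `Q.tail
      -- a` can occur.
      have hba : c.arr b = a := hρ.tail_injective ((c.tail_arr b).trans hp)
      obtain ⟨b', h1, h2, h3⟩ := hfb b
      rw [fibreMap_single hG b hba, he]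
      have hF1 : F _ ⟨G.tail b, hp⟩ = ⟨G.tail b', by rw [← c.tail_arr, h3, hba]⟩ :=
        Subtype.ext h1.symm
      rw [hF1, fibreMap_single hG b' (h3.trans hba)]
      congr 1
      exact Subtype.ext h2.symm
  have hidem : ∀ x, e x ∘ₗ e x = e x := by
    refine fun x => LinearMap.pi_ext' fun p => LinearMap.ext_ring ?_
    simp only [LinearMap.comp_apply, LinearMap.coe_single, he]
    congr 1
    exact Subtype.ext (hff _)
  rcases h.eq_zero_or_eq_id e (fun a s => LinearMap.congr_fun (hcomm a) s)
    (fun x s => LinearMap.congr_fun (hidem x) s) with h0 | h0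
  · have h1 : Pi.single (F _ ⟨r, rfl⟩) 1 = (0 : FibreSpace K c (c.vert r)) := by
      rw [← he]
      exact LinearMap.congr_fun (h0 (c.vert r)) _
    have := congrFun h1 (F _ ⟨r, rfl⟩)
    simp at this
  · have h1 : Pi.single (F _ ⟨y, rfl⟩) 1 =
        (Pi.single ⟨y, rfl⟩ 1 : FibreSpace K c (c.vert y)) := by
      rw [← he]
      exact LinearMap.congr_fun (h0 (c.vert y)) _
    have h2 : F _ ⟨y, rfl⟩ ≠ ⟨y, rfl⟩ := fun h => hy (congrArg Subtype.val h)
    have := congrFun h1 (F _ ⟨y, rfl⟩)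
    rw [Pi.single_eq_same, Pi.single_eq_of_ne h2] at this
    exact one_ne_zero this

end Linearization

/-! ### Isomorphic representations have equal root shapes -/

section Isomorphism

variable {K : Type k} [Field K] {Q : DirGraph.{u, v}} [Q.IsRootedTree] {G : DirGraph.{u', v'}}
  [Finite G.Vert] [Finite G.Arr] {H : DirGraph.{w, w'}} [Finite H.Vert] [Finite H.Arr]
  {c : Hom G Q} {d : Hom H Q}

theorem exists_shape_le_of_iso {r : G.Vert} (hG : G.IsArborescence r)
    (e : (fibreRep K c).Iso (fibreRep K d)) :
    ∃ z, shape c r ≤ shape d z := by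
  classical
  let φ : ∀ x, FibreSpace K c x ≃ₗ[K] FibreSpace K d x := e.equiv
  have hφ : φ (c.vert r) (Pi.single ⟨r, rfl⟩ 1) ≠ 0 := by
    rw [Ne, LinearEquiv.map_eq_zero_iff]
    intro h
    simpa using congrFun h ⟨r, rfl⟩
  obtain ⟨z, hz⟩ := Function.ne_iff.1 hφ
  exact ⟨z.1, shape_le_of_single_ne_zero (φ := fun x => (φ x).toLinearMap) hG e.comm _ ⟨r, rfl⟩ z hz⟩

/-- The isomorphism and its inverse place the image of each root on the path below the other.
Acyclicity of `Q` makes these images equal, and a root is alone in its fibre, so the two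
inequalities compare the roots themselves. -/
theorem shape_eq_of_iso {r : G.Vert} {s : H.Vert} (hG : G.IsArborescence r)
    (hH : H.IsArborescence s)
    (e : (fibreRep K c).Iso (fibreRep K d)) : shape c r = shape d s := by
  obtain ⟨z, hz⟩ := exists_shape_le_of_iso hG e
  obtain ⟨y, hy⟩ := exists_shape_le_of_iso hH e.symm
  have h1 := hH.vert_reflTransGen d z
  have h2 := hG.vert_reflTransGen c y
  rw [← vert_eq_of_shape_le hz] at h1
  rw [← vert_eq_of_shape_le hy] at h2
  have h := eq_of_reflTransGen h1 h2
  obtain rfl := hH.eq_root d ((vert_eq_of_shape_le hz).symm.trans h)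
  obtain rfl := hG.eq_root c ((vert_eq_of_shape_le hy).symm.trans h.symm)
  exact le_antisymm hz hy

end Isomorphism

/-! ### Identifying the direct-sum pushforward with its coordinate form -/

section Coordinates

variable {K : Type k} [Field K] {Q : DirGraph.{u, v}} {G : DirGraph.{u', v'}}
  [Finite G.Vert] [Finite G.Arr]

open Classical in
theorem pushforward_one_map_apply (c : Hom G Q) {a : Q.Arr}
    (s : ⨁ _ : {y : G.Vert // c.vert y = Q.tail a}, K)
    (z : {y : G.Vert // c.vert y = Q.head a}) :
    letI := Fintype.ofFinite {b : G.Arr // c.arr b = a}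
    (show ⨁ _ : {y : G.Vert // c.vert y = Q.head a}, K from
      (Rep.pushforward c (Rep.one K G)).map a s) z =
        ∑ b : {b : G.Arr // c.arr b = a},
          if G.head b.1 = z.1 then s ⟨G.tail b.1, by rw [← c.tail_arr, b.2]⟩ else 0 := by
  let _ := Fintype.ofFinite {b : G.Arr // c.arr b = a}
  change ((∑ b : {b : G.Arr // c.arr b = a},
    DirectSum.lof K {y : G.Vert // c.vert y = Q.head a} (fun _ => K)
      ⟨G.head b, by rw [← c.head_arr, b.2]⟩ ∘ₗ LinearMap.id ∘ₗ
        DirectSum.component K {y : G.Vert // c.vert y = Q.tail a} (fun _ => K)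
          ⟨G.tail b, by rw [← c.tail_arr, b.2]⟩) s) z = _
  rw [LinearMap.sum_apply, DFinsupp.finsetSum_apply]
  refine Finset.sum_congr rfl fun b _ => ?_
  simp only [LinearMap.comp_apply, LinearMap.id_apply, DirectSum.lof_eq_of, DirectSum.of_apply]
  by_cases h : G.head b.1 = z.1
  · rw [dif_pos (Subtype.ext h), if_pos h]
    obtain ⟨z, hz⟩ := z
    dsimp only at h
    subst h
    rfl
  · rw [dif_neg fun e => h (congrArg Subtype.val e), if_neg h]

open Classical in
/-- The pushforward of the constant representation is given in coordinates by `fibreRep`. -/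
noncomputable def pushforwardOneIso (K : Type k) [Field K] (c : Hom G Q) :
    (Rep.pushforward c (Rep.one K G)).Iso (fibreRep K c) where
  equiv x :=
    letI := Fintype.ofFinite {y : G.Vert // c.vert y = x}
    DirectSum.linearEquivFunOnFintype K {y : G.Vert // c.vert y = x} (fun _ => K)
  comm a s := by
    let _ := Fintype.ofFinite G.Arr
    let _ := Fintype.ofFinite {b : G.Arr // c.arr b = a}
    funext z
    refine (pushforward_one_map_apply c s z).trans
      (Eq.trans ?_ (fibreMap_apply c (fun y => DFunLike.coe
        (F := ⨁ _ : {y : G.Vert // c.vert y = Q.tail a}, K) s y) z).symm)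
    rw [← Finset.sum_filter]
    refine Finset.sum_bij' (fun b hb => ⟨b.1, b.2, (Finset.mem_filter.1 hb).2⟩)
      (fun b _ => ⟨b.1, b.2.1⟩) ?_ ?_ ?_ ?_ ?_
    · exact fun _ _ => Finset.mem_univ _
    · exact fun b _ => Finset.mem_filter.2 ⟨Finset.mem_univ _, b.2.2⟩
    · exact fun _ _ => rfl
    · exact fun _ _ => rfl
    · exact fun _ _ => rfl

end Coordinates

end DirGraph

theorem corollary3 {K : Type k} [Field K] (Q : DirGraph.{u, v}) [Q.IsRootedTree] :
    (∀ (Q' : DirGraph.{u', v'}) [Q'.IsRootedTree] (c : DirGraph.Hom Q' Q),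
      (DirGraph.Rep.pushforward c (DirGraph.Rep.one K Q')).Indecomposable ↔
        DirGraph.IsReduced c) ∧
    (∀ M : Q.L, (DirGraph.redRep K M).Indecomposable) ∧
    (∀ M N : Q.L, M ≠ N →
      ¬ Nonempty ((DirGraph.redRep K M).Iso (DirGraph.redRep K N))) := by
  classical
  refine ⟨fun Q' _ c => ?_, fun M => ?_, fun M N hMN => ?_⟩
  · obtain ⟨r, hr⟩ := DirGraph.IsRootedTree.exists_isArborescence Q'
    rw [DirGraph.isReduced_iff_isThin hr, (DirGraph.pushforwardOneIso K c).indecomposable_iff]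
    exact ⟨DirGraph.isThin_of_indecomposable hr, DirGraph.IsThin.indecomposable hr⟩
  · exact (DirGraph.pushforwardOneIso K _).symm.indecomposable
      ((DirGraph.redMap_isThin M).indecomposable (DirGraph.red_isArborescence M))
  · rintro ⟨e⟩
    apply hMN
    rw [← DirGraph.shape_redMap_root M, ← DirGraph.shape_redMap_root N]
    exact DirGraph.shape_eq_of_iso (DirGraph.red_isArborescence M)
      (DirGraph.red_isArborescence N)
      (((DirGraph.pushforwardOneIso K _).symm.trans e).trans (DirGraph.pushforwardOneIso K _))
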